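/- Let $n\ge 1$ and $a,b\ge 0$ be integers and put $k=a+b$. A $\mathbb{C}$-linear map $\Phi:M_n(\mathbb{C})\to M_n(\mathbb{C})^{\otimes a}\otimes M_n(\mathbb{C})^{\otimes b}= M_{n^k}(\mathbb{C})$ is called \emph{$(a,b)$-unitarily equivariant} if $$\Phi(UXU^*)=(\overline{U}^{\otimes a}\otimes U^{\otimes b})\,\Phi(X)\,(\overline{U}^{\otimes a}\otimes U^{\otimes b})^*$$ for every unitary $U\in M_n(\mathbb{C})$ and every $X\in M_n(\mathbb{C})$; these maps form a complex vector space $W_{a,b}$. The Choi matrix of a linear map $\Phi$ as above is $C_\Phi=\sum_{i,j=1}^n e_{ij}\otimes\Phi(e_{ij})\in M_n(\mathbb{C})^{\otimes(k+1)}$, where the $e_{ij}$ are the matrix units. For $\pi\in S_{k+1}$ let $\sigma_{k+1}(\pi)$ be the operator on $(\mathbb{C}^n)^{\otimes(k+1)}$ with $$\sigma_{k+1}(\pi)(v_1\otimes\cdots\otimes v_{k+1})=v_{\pi^{-1}(1)}\otimes\cdots\otimes v_{\pi^{-1}(k+1)},$$ and let $\theta_n(A)=A^t$ and $i_n(A)=A$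 on $M_n(\mathbb{C})$. Then for each $\pi\in S_{k+1}$ there is exactly one linear map $\Phi_\pi:M_n(\mathbb{C})\to M_n(\mathbb{C})^{\otimes a}\otimes M_n(\mathbb{C})^{\otimes b}$ with Choi matrix $$C_{\Phi_\pi}=(\theta_n^{\otimes(a+1)}\otimes i_n^{\otimes b})[\sigma_{k+1}(\pi)],$$ and the maps $\Phi_\pi$, $\pi\in S_{k+1}$, span the vector space $W_{a,b}$. If moreover $n\ge k+1$, then the family $(\Phi_\pi)_{\pi\in S_{k+1}}$ is a basis of $W_{a,b}$, and $\dim_{\mathbb{C}} W_{a,b}=(k+1)!$. -/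

import Mathlib

open scoped Matrix Kronecker Nat

noncomputable section

namespace EquivariantMaps

/-- The algebra `M_n(ℂ)^{⊗k} = M_{n^k}(ℂ)`; the canonical basis of `(ℂ^n)^{⊗k}`, consisting of the
vectors `e_{x 0} ⊗ ⋯ ⊗ e_{x (k-1)}`, is indexed by the words `x : Fin k → Fin n`. -/
abbrev TMat (n k : ℕ) : Type := Matrix (Fin k → Fin n) (Fin k → Fin n) ℂ

/-- The elementary tensor `v_0 ⊗ ⋯ ⊗ v_{k-1}` in `(ℂ^n)^{⊗k}`, in coordinates. -/
def tensorVec {n k : ℕ} (v : Fin k → Fin n → ℂ) : (Fin k → Fin n) → ℂ :=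
  fun x => ∏ i, v i (x i)

/-- The elementary tensor `A_0 ⊗ ⋯ ⊗ A_{k-1}` in `M_n(ℂ)^{⊗k}` (iterated Kronecker product). -/
def tensorMat {n k : ℕ} (A : Fin k → Matrix (Fin n) (Fin n) ℂ) : TMat n k :=
  Matrix.of fun x y => ∏ i, A i (x i) (y i)

/-- `(A_0 ⊗ ⋯ ⊗ A_{k-1}) (v_0 ⊗ ⋯ ⊗ v_{k-1}) = A_0 v_0 ⊗ ⋯ ⊗ A_{k-1} v_{k-1}`. -/
theorem tensorMat_mulVec {n k : ℕ} (A : Fin k → Matrix (Fin n) (Fin n) ℂ)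
    (v : Fin k → Fin n → ℂ) :
    tensorMat A *ᵥ tensorVec v = tensorVec fun i => A i *ᵥ v i := by
  funext x
  simp only [Matrix.mulVec, dotProduct, tensorMat, tensorVec, Matrix.of_apply]
  rw [Finset.prod_univ_sum]
  simp [Finset.prod_mul_distrib]

/-- The matrix `Ū^{⊗a} ⊗ U^{⊗b}`, where `Ū` is the entrywise complex conjugate of `U`. -/
def mixedPower {n : ℕ} (a b : ℕ) (U : Matrix (Fin n) (Fin n) ℂ) : TMat n (a + b) :=
  tensorMat fun i => if (i : ℕ) < a then U.map star else U

/-- `Φ : M_n(ℂ) → M_n(ℂ)^{⊗a} ⊗ M_n(ℂ)^{⊗b}` is `(a,b)`-unitarily equivariant. -/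
def IsUnitarilyEquivariant {n : ℕ} (a b : ℕ)
    (Φ : Matrix (Fin n) (Fin n) ℂ →ₗ[ℂ] TMat n (a + b)) : Prop :=
  ∀ U ∈ Matrix.unitaryGroup (Fin n) ℂ, ∀ X : Matrix (Fin n) (Fin n) ℂ,
    Φ (U * X * Uᴴ) = mixedPower a b U * Φ X * (mixedPower a b U)ᴴ

/-- The complex vector space of all `(a,b)`-unitarily equivariant maps. -/
def equivariantMaps (n a b : ℕ) :
    Submodule ℂ (Matrix (Fin n) (Fin n) ℂ →ₗ[ℂ] TMat n (a + b)) where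
  carrier := {Φ | IsUnitarilyEquivariant a b Φ}
  zero_mem' := by
    intro U _ X
    simp
  add_mem' := by
    intro Φ Ψ hΦ hΨ U hU X
    simp [hΦ U hU X, hΨ U hU X, mul_add, add_mul]
  smul_mem' := by
    intro c Φ hΦ U hU X
    simp [hΦ U hU X]

/-- The tensor product `A ⊗ B` of `A ∈ M_n(ℂ)` and `B ∈ M_n(ℂ)^{⊗k}`, in `M_n(ℂ)^{⊗(k+1)}`. -/
def consTensor {n k : ℕ} (A : Matrix (Fin n) (Fin n) ℂ) (B : TMat n k) : TMat n (k + 1) :=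
  Matrix.reindex (Fin.consEquiv fun _ => Fin n) (Fin.consEquiv fun _ => Fin n) (A ⊗ₖ B)

/-- `A_0 ⊗ (A_1 ⊗ ⋯ ⊗ A_k) = A_0 ⊗ A_1 ⊗ ⋯ ⊗ A_k`. -/
theorem consTensor_tensorMat {n k : ℕ} (A : Matrix (Fin n) (Fin n) ℂ)
    (B : Fin k → Matrix (Fin n) (Fin n) ℂ) :
    consTensor A (tensorMat B) = tensorMat (Fin.cons A B : Fin (k + 1) → _) := by
  ext x y
  simp [consTensor, tensorMat, Fin.consEquiv, Fin.prod_univ_succ, Fin.tail]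

/-- The Choi matrix `C_Φ = (id ⊗ Φ)(B B^*) = ∑_{i,j} e_{ij} ⊗ Φ(e_{ij})`, where
`B = ∑_i e_i ⊗ e_i`. -/
def choiMatrix {n k : ℕ} (Φ : Matrix (Fin n) (Fin n) ℂ →ₗ[ℂ] TMat n k) : TMat n (k + 1) :=
  ∑ i, ∑ j, consTensor (Matrix.single i j 1) (Φ (Matrix.single i j 1))

theorem choiMatrix_apply {n k : ℕ} (Φ : Matrix (Fin n) (Fin n) ℂ →ₗ[ℂ] TMat n k)
    (x y : Fin (k + 1) → Fin n) :
    choiMatrix Φ x y = Φ (Matrix.single (x 0) (y 0) 1) (Fin.tail x) (Fin.tail y) := by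
  simp [choiMatrix, consTensor, Matrix.sum_apply, Fin.consEquiv, Matrix.single_apply, ite_and]

/-- The linear map whose Choi matrix is the given matrix. -/
def ofChoiMatrix {n k : ℕ} (C : TMat n (k + 1)) :
    Matrix (Fin n) (Fin n) ℂ →ₗ[ℂ] TMat n k where
  toFun X := Matrix.of fun x y => ∑ i, ∑ j,
    X i j * C (Fin.cons i x : Fin (k + 1) → Fin n) (Fin.cons j y : Fin (k + 1) → Fin n)
  map_add' X Y := by
    ext x y
    simp [add_mul, Finset.sum_add_distrib]
  map_smul' c X := by
    ext x y
    simp [Finset.mul_sum, mul_assoc]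

theorem choiMatrix_ofChoiMatrix {n k : ℕ} (C : TMat n (k + 1)) :
    choiMatrix (ofChoiMatrix C) = C := by
  ext x y
  simp [choiMatrix_apply, ofChoiMatrix, Matrix.single_apply, ite_and]

theorem ofChoiMatrix_choiMatrix {n k : ℕ} (Φ : Matrix (Fin n) (Fin n) ℂ →ₗ[ℂ] TMat n k) :
    ofChoiMatrix (choiMatrix Φ) = Φ := by
  ext X x y
  conv_rhs => rw [Matrix.matrix_eq_sum_single X]
  have h : ∀ i j, Matrix.single i j (X i j) = X i j • Matrix.single i j (1 : ℂ) := by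
    simp
  simp only [h, map_sum, map_smul, Matrix.sum_apply, Matrix.smul_apply, smul_eq_mul]
  simp [choiMatrix_apply, ofChoiMatrix]

/-- The operator `σ_k(π)` on `(ℂ^n)^{⊗k}`; see `permMat_mulVec`. -/
def permMat (n : ℕ) {k : ℕ} (π : Equiv.Perm (Fin k)) : TMat n k :=
  Matrix.of fun x y => if x = (fun i => y (π⁻¹ i)) then 1 else 0

/-- `σ_k(π) (v_1 ⊗ ⋯ ⊗ v_k) = v_{π⁻¹(1)} ⊗ ⋯ ⊗ v_{π⁻¹(k)}`. -/
theorem permMat_mulVec {n k : ℕ} (π : Equiv.Perm (Fin k)) (v : Fin k → Fin n → ℂ) :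
    permMat n π *ᵥ tensorVec v = tensorVec fun i => v (π⁻¹ i) := by
  funext x
  have h : ∀ y : Fin k → Fin n, (x = fun i => y (π⁻¹ i)) ↔ y = fun i => x (π i) := by
    intro y
    constructor
    · rintro rfl
      simp
    · rintro rfl
      simp
  simp only [Matrix.mulVec, dotProduct, permMat, tensorVec, Matrix.of_apply, h, ite_mul, one_mul,
    zero_mul, Finset.sum_ite_eq', Finset.mem_univ, if_true]
  rw [← Equiv.prod_comp π fun i => v (π⁻¹ i) (x i)]
  simp

/-- The partial transposition `θ^{⊗m} ⊗ id^{⊗(k-m)}` on `M_n(ℂ)^{⊗k}`: row and column indices are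
exchanged in the first `m` tensor factors; see `partialTranspose_tensorMat`. -/
def partialTranspose {n k : ℕ} (m : ℕ) : TMat n k →ₗ[ℂ] TMat n k where
  toFun C := Matrix.of fun x y =>
    C (fun i => if (i : ℕ) < m then y i else x i) (fun i => if (i : ℕ) < m then x i else y i)
  map_add' _ _ := rfl
  map_smul' _ _ := rfl

/-- The partial transposition transposes the first `m` factors of an elementary tensor. -/
theorem partialTranspose_tensorMat {n k : ℕ} (m : ℕ) (A : Fin k → Matrix (Fin n) (Fin n) ℂ) :
    partialTranspose m (tensorMat A) =
      tensorMat fun i => if (i : ℕ) < m then (A i)ᵀ else A i := by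
  ext x y
  change (∏ i : Fin k, A i (if (i : ℕ) < m then y i else x i) (if (i : ℕ) < m then x i else y i)) =
    ∏ i : Fin k, (if (i : ℕ) < m then (A i)ᵀ else A i) (x i) (y i)
  refine Finset.prod_congr rfl fun i _ => ?_
  split_ifs <;> rfl

/-- The map `Φ_π`, `π ∈ S_{a+b+1}`, with Choi matrix `(θ^{⊗(a+1)} ⊗ id^{⊗b})[σ_{a+b+1}(π)]`. -/
def permMap (n a b : ℕ) (π : Equiv.Perm (Fin (a + b + 1))) :
    Matrix (Fin n) (Fin n) ℂ →ₗ[ℂ] TMat n (a + b) :=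
  ofChoiMatrix (partialTranspose (a + 1) (permMat n π))

end EquivariantMaps

end

/-! Taking Choi matrices and transposing the first `a + 1` factors is a linear isomorphism. It turns
equivariance of `Φ` into commutation of a tensor with all `U ⊗ ⋯ ⊗ U`, `U` unitary, and sends
`permMat n π` to `permMap n a b π`. What remains is Schur–Weyl duality for the unitary group
(`mem_span_permMat`), plus independence of the permutation operators when `k ≤ n`.

Duality has two halves. Commuting with unitary powers forces commuting with powers of diagonal
matrices, then of Hermitian ones by diagonalization, then with all symmetrized tensors by
polarization; these span the permutation-invariant tensors (`commute_of_commute_permMat`). The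
second half is the double commutant theorem: a Maschke-averaged projection onto the span of the
permutation operators has blocks commuting with every permutation operator, hence with `T`, and
applying it to `T = T * 1` puts `T` in the span. -/

noncomputable section

namespace EquivariantMaps

open Equiv

/-! ### Polarization of multilinear maps -/

/-- Polarization: the symmetrization of a multilinear map is determined by its values on the
diagonal. -/
theorem sum_neg_one_pow_card_smul_multilinear {ι M N : Type*} [Fintype ι] [DecidableEq ι]
    [AddCommGroup M] [Module ℂ M] [AddCommGroup N] [Module ℂ N]
    (f : MultilinearMap ℂ (fun _ : ι => M) N) (v : ι → M) :
    ∑ s : Finset ι, (-1 : ℂ) ^ s.card • f (fun _ => ∑ j ∈ s, v j) =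
      (-1 : ℂ) ^ Fintype.card ι • ∑ π : Perm ι, f (fun i => v (π i)) := by
  -- Inclusion–exclusion: this is the coefficient of `f (v ∘ g)` in the left side. It is the
  -- expansion of `∏ j, (-1 + [j ∉ range g])`, which has a zero factor as soon as `g` misses a
  -- point.
  have hcoeff : ∀ g : ι → ι, ∑ s : Finset ι, (if ∀ i, g i ∈ s then (-1 : ℂ) ^ s.card else 0) =
      if Function.Bijective g then (-1 : ℂ) ^ Fintype.card ι else 0 := by
    intro g
    have h1 := Fintype.prod_add (fun _ : ι => (-1 : ℂ))
      (fun j => if ∃ i, g i = j then 0 else 1)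
    have h2 : ∀ s : Finset ι, (if ∀ i, g i ∈ s then (-1 : ℂ) ^ s.card else 0) =
        (∏ _a ∈ s, (-1 : ℂ)) * ∏ a ∈ sᶜ, (if ∃ i, g i = a then (0 : ℂ) else 1) := by
      intro s
      rw [Finset.prod_const]
      split_ifs with h
      · rw [Finset.prod_eq_one, mul_one]
        intro a ha
        rw [if_neg]
        rintro ⟨i, rfl⟩
        exact Finset.mem_compl.1 ha (h i)
      · push Not at h
        obtain ⟨i, hi⟩ := h
        have h0 : (if ∃ j, g j = g i then (0 : ℂ) else 1) = 0 := if_pos ⟨i, rfl⟩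
        rw [Finset.prod_eq_zero (Finset.mem_compl.2 hi) h0, mul_zero]
    rw [Finset.sum_congr rfl fun s _ => h2 s, ← h1]
    split_ifs with hg
    · rw [Finset.prod_congr rfl fun a _ => by rw [if_pos (hg.2 a), add_zero]]
      simp
    · have : ¬ Function.Surjective g := fun h => hg (Finite.surjective_iff_bijective.1 h)
      simp only [Function.Surjective, not_forall] at this
      obtain ⟨a, ha⟩ := this
      exact Finset.prod_eq_zero (Finset.mem_univ a) (by rw [if_neg ha]; simp)
  have hexp : ∀ s : Finset ι, f (fun _ => ∑ j ∈ s, v j) =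
      ∑ g : ι → ι, if ∀ i, g i ∈ s then f (fun i => v (g i)) else 0 := by
    intro s
    rw [f.map_sum_finset (fun _ j => v j) (fun _ => s), ← Finset.sum_filter]
    refine Finset.sum_congr ?_ fun _ _ => rfl
    ext g
    simp
  simp_rw [hexp, Finset.smul_sum]
  rw [Finset.sum_comm]
  have : ∀ g : ι → ι, ∑ s : Finset ι,
      (-1 : ℂ) ^ s.card • (if ∀ i, g i ∈ s then f (fun i => v (g i)) else 0) =
      if Function.Bijective g then (-1 : ℂ) ^ Fintype.card ι • f (fun i => v (g i)) else 0 := by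
    intro g
    rw [← ite_zero_smul, ← hcoeff g, Finset.sum_smul]
    refine Finset.sum_congr rfl fun s _ => ?_
    split_ifs <;> simp
  rw [Finset.sum_congr rfl fun g _ => this g, ← Finset.sum_filter]
  symm
  refine Finset.sum_bij (fun π _ => ⇑π) (by simp) ?_ ?_ (by simp)
  · intro π _ τ _ h
    exact DFunLike.coe_injective h
  · intro g hg
    exact ⟨Equiv.ofBijective g (by simpa using hg), Finset.mem_univ _, rfl⟩

/-- A multilinear map is zero if it vanishes on families taken from a spanning set. -/
theorem multilinear_eq_zero_of_span {ι M N : Type*} [Finite ι]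
    [AddCommGroup M] [Module ℂ M] [AddCommGroup N] [Module ℂ N]
    (f : MultilinearMap ℂ (fun _ : ι => M) N) {s : Set M} (hs : Submodule.span ℂ s = ⊤)
    (h : ∀ v : ι → M, (∀ i, v i ∈ s) → f v = 0) : f = 0 :=
  Module.Basis.ext_multilinear (fun _ => Module.Basis.ofSpan hs.ge) fun v =>
    h _ fun i => Module.Basis.ofSpan_subset hs.ge ⟨v i, rfl⟩

/-! ### Algebra of elementary tensors and permutation operators -/

variable {n k : ℕ}

/-- The elementary tensor as a multilinear map. -/
def tensorMatMultilinear (n k : ℕ) :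
    MultilinearMap ℂ (fun _ : Fin k => Matrix (Fin n) (Fin n) ℂ) (TMat n k) where
  toFun := tensorMat
  map_update_add' A i X Y := by
    ext x y
    exact ((MultilinearMap.mkPiAlgebra ℂ (Fin k) ℂ).compLinearMap
      (fun i => Matrix.entryLinearMap ℂ ℂ (x i) (y i))).map_update_add A i X Y
  map_update_smul' A i c X := by
    ext x y
    exact ((MultilinearMap.mkPiAlgebra ℂ (Fin k) ℂ).compLinearMap
      (fun i => Matrix.entryLinearMap ℂ ℂ (x i) (y i))).map_update_smul A i c X

@[simp]
theorem tensorMatMultilinear_apply (A : Fin k → Matrix (Fin n) (Fin n) ℂ) :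
    tensorMatMultilinear n k A = tensorMat A := rfl

theorem tensorMat_mul (A B : Fin k → Matrix (Fin n) (Fin n) ℂ) :
    tensorMat A * tensorMat B = tensorMat fun i => A i * B i := by
  ext x y
  simp only [Matrix.mul_apply, tensorMat, Matrix.of_apply]
  rw [Finset.prod_univ_sum]
  simp [Finset.prod_mul_distrib]

theorem tensorMat_one : tensorMat (fun _ : Fin k => (1 : Matrix (Fin n) (Fin n) ℂ)) = 1 := by
  ext x y
  simp only [tensorMat, Matrix.of_apply, Matrix.one_apply, funext_iff]
  split_ifs with h
  · exact Finset.prod_eq_one fun i _ => if_pos (h i)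
  · push Not at h
    obtain ⟨i, hi⟩ := h
    exact Finset.prod_eq_zero (Finset.mem_univ i) (if_neg hi)

theorem tensorMat_conjTranspose (A : Fin k → Matrix (Fin n) (Fin n) ℂ) :
    (tensorMat A)ᴴ = tensorMat fun i => (A i)ᴴ := by
  ext x y
  simp [tensorMat, Matrix.conjTranspose_apply]

theorem tensorMat_single (u v : Fin k → Fin n) :
    tensorMat (fun i => Matrix.single (u i) (v i) (1 : ℂ)) = Matrix.single u v 1 := by
  ext x y
  simp only [tensorMat, Matrix.of_apply, Matrix.single_apply]
  split_ifs with h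
  · obtain ⟨rfl, rfl⟩ := h
    simp
  · rw [funext_iff, funext_iff, ← forall_and, not_forall] at h
    obtain ⟨i, hi⟩ := h
    exact Finset.prod_eq_zero (Finset.mem_univ i) (if_neg hi)

theorem linearMap_ext_tensorMat {V : Type*} [AddCommGroup V] [Module ℂ V]
    {f g : TMat n k →ₗ[ℂ] V} (h : ∀ A, f (tensorMat A) = g (tensorMat A)) : f = g := by
  refine Matrix.ext_linearMap _ fun u v => LinearMap.ext_ring ?_
  simpa [tensorMat_single] using h fun i => Matrix.single (u i) (v i) 1

theorem tensorMat_mul_permMat (A : Fin k → Matrix (Fin n) (Fin n) ℂ) (π : Perm (Fin k)) :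
    tensorMat A * permMat n π = permMat n π * tensorMat fun i => A (π i) := by
  ext x y
  have h : ∀ z : Fin k → Fin n, (x = fun i => z (π⁻¹ i)) ↔ z = fun i => x (π i) := by
    intro z
    constructor <;> rintro rfl <;> simp
  simp only [Matrix.mul_apply, permMat, tensorMat, Matrix.of_apply, h, mul_ite, mul_one, mul_zero,
    ite_mul, one_mul, zero_mul, Finset.sum_ite_eq', Finset.mem_univ, if_true]
  rw [← Equiv.prod_comp π]
  simp

theorem permMat_mul (π τ : Perm (Fin k)) : permMat n π * permMat n τ = permMat n (π * τ) := by
  ext x y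
  simp [Matrix.mul_apply, permMat]

theorem permMat_one : permMat n (1 : Perm (Fin k)) = 1 := by
  ext x y
  simp [permMat, Matrix.one_apply]

/-! ### From unitary powers to permutation-invariant tensors -/

theorem prod_update_one_word (x : Fin k → Fin n) (j : Fin n) (z : ℂ) :
    ∏ i, Function.update (fun _ => (1 : ℂ)) j z (x i) =
      z ^ (Finset.univ.filter fun i => x i = j).card := by
  simp only [Function.update_apply]
  rw [Finset.prod_ite, Finset.prod_const, Finset.prod_const_one, mul_one]

theorem tensorMat_diagonal (d : Fin n → ℂ) :
    tensorMat (fun _ : Fin k => Matrix.diagonal d) = Matrix.diagonal fun x => ∏ i, d (x i) := by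
  ext x y
  simp only [tensorMat, Matrix.of_apply, Matrix.diagonal_apply, funext_iff]
  split_ifs with h
  · exact Finset.prod_congr rfl fun i _ => if_pos (h i)
  · push Not at h
    obtain ⟨i, hi⟩ := h
    exact Finset.prod_eq_zero (Finset.mem_univ i) (if_neg hi)

/-- A tensor commuting with the powers of all diagonal unitaries commutes with the powers of all
diagonal matrices. -/
theorem commute_tensorMat_diagonal {T : TMat n k}
    (hT : ∀ U ∈ Matrix.unitaryGroup (Fin n) ℂ, Commute T (tensorMat fun _ => U))
    (d : Fin n → ℂ) : Commute T (tensorMat fun _ => Matrix.diagonal d) := by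
  -- Letter counts of words of length `k` lie in `0, …, k`, so powers of a primitive root of unity
  -- of order `k + 1` separate them.
  have hz := Complex.isPrimitiveRoot_exp (k + 1) k.succ_ne_zero
  set z := Complex.exp (2 * Real.pi * Complex.I / ((k + 1 : ℕ) : ℂ))
  have hnorm : ‖z‖ = 1 := hz.norm'_eq_one k.succ_ne_zero
  have hzz : z * star z = 1 := by
    rw [RCLike.star_def, Complex.mul_conj, Complex.normSq_eq_norm_sq, hnorm]
    simp
  -- Testing against the diagonal unitary with `z` at place `j` shows that `T` preserves weights: a
  -- nonzero entry joins words with equal letter counts.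
  have hcount : ∀ x y, T x y ≠ 0 → ∀ j, (Finset.univ.filter fun i => x i = j).card =
      (Finset.univ.filter fun i => y i = j).card := by
    intro x y hxy j
    have hU : Matrix.diagonal (Function.update (fun _ => (1 : ℂ)) j z) ∈
        Matrix.unitaryGroup (Fin n) ℂ := by
      rw [Matrix.mem_unitaryGroup_iff, Matrix.star_eq_conjTranspose, Matrix.diagonal_conjTranspose,
        Matrix.diagonal_mul_diagonal, ← Matrix.diagonal_one]
      congr 1
      funext i
      by_cases h : i = j
      · subst h; simpa using hzz
      · simp [h]
    have h := congrFun (congrFun (hT _ hU).eq x) y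
    rw [tensorMat_diagonal, Matrix.mul_diagonal, Matrix.diagonal_mul, prod_update_one_word,
      prod_update_one_word, mul_comm] at h
    have hlt : ∀ w : Fin k → Fin n, (Finset.univ.filter fun i => w i = j).card < k + 1 :=
      fun w => Nat.lt_succ_of_le ((Finset.card_le_univ _).trans (Fintype.card_fin k).le)
    exact (hz.pow_inj (hlt y) (hlt x) (mul_right_cancel₀ hxy h)).symm
  have hprod : ∀ x : Fin k → Fin n, ∏ i, d (x i) =
      ∏ j, d j ^ (Finset.univ.filter fun i => x i = j).card := by
    intro x
    rw [← Finset.prod_fiberwise Finset.univ x]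
    refine Finset.prod_congr rfl fun j _ => ?_
    rw [← Finset.prod_const]
    exact Finset.prod_congr rfl fun i hi => by rw [(Finset.mem_filter.1 hi).2]
  ext x y
  rw [tensorMat_diagonal, Matrix.mul_diagonal, Matrix.diagonal_mul]
  by_cases hxy : T x y = 0
  · simp [hxy]
  · rw [hprod, hprod, mul_comm]
    simp [hcount x y hxy]

theorem commute_tensorMat_of_isHermitian {T : TMat n k}
    (hT : ∀ U ∈ Matrix.unitaryGroup (Fin n) ℂ, Commute T (tensorMat fun _ => U))
    {H : Matrix (Fin n) (Fin n) ℂ} (hH : H.IsHermitian) :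
    Commute T (tensorMat fun _ => H) := by
  rw [hH.spectral_theorem, Unitary.conjStarAlgAut_apply, ← tensorMat_mul, ← tensorMat_mul]
  exact ((hT _ hH.eigenvectorUnitary.2).mul_right (commute_tensorMat_diagonal hT _)).mul_right
    (hT _ (star hH.eigenvectorUnitary).2)

/-- A tensor commuting with `U ⊗ ⋯ ⊗ U` for all unitary `U` commutes with all symmetrized
elementary tensors. -/
theorem commute_sum_perm_tensorMat {T : TMat n k}
    (hT : ∀ U ∈ Matrix.unitaryGroup (Fin n) ℂ, Commute T (tensorMat fun _ => U))
    (A : Fin k → Matrix (Fin n) (Fin n) ℂ) :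
    Commute T (∑ π : Perm (Fin k), tensorMat fun i => A (π i)) := by
  -- The commutator of `T` with the symmetrized tensor is multilinear in `A`, so it need only vanish
  -- on Hermitian matrices, which span. There polarization expresses it through powers of sums,
  -- again Hermitian.
  let f : MultilinearMap ℂ (fun _ : Fin k => Matrix (Fin n) (Fin n) ℂ) (TMat n k) :=
    (LinearMap.mulLeft ℂ T - LinearMap.mulRight ℂ T).compMultilinearMap
      (∑ π : Perm (Fin k), (tensorMatMultilinear n k).domDomCongr π)
  have hf : ∀ A, f A = T * (∑ π : Perm (Fin k), tensorMat fun i => A (π i)) -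
      (∑ π : Perm (Fin k), tensorMat fun i => A (π i)) * T := by
    intro A
    simp [f, Finset.mul_sum, Finset.sum_mul]
  have hf0 : f = 0 := by
    refine multilinear_eq_zero_of_span f
      (span_selfAdjoint (A := Matrix (Fin n) (Fin n) ℂ)) fun v hv => ?_
    rw [hf, sub_eq_zero]
    have hpol := sum_neg_one_pow_card_smul_multilinear (tensorMatMultilinear n k) v
    have hc : Commute T (∑ s : Finset (Fin k),
        (-1 : ℂ) ^ s.card • tensorMatMultilinear n k (fun _ => ∑ j ∈ s, v j)) := by
      refine Commute.sum_right _ _ _ fun s _ => Commute.smul_right ?_ _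
      refine commute_tensorMat_of_isHermitian hT ?_
      exact sum_mem (S := selfAdjoint (Matrix (Fin n) (Fin n) ℂ)) fun j _ => hv j
    rw [hpol] at hc
    exact (Commute.smul_right_iff₀ (pow_ne_zero _ (neg_ne_zero.2 one_ne_zero))).1 hc
  have h := hf A
  rw [hf0] at h
  exact sub_eq_zero.1 h.symm

theorem permMat_mul_apply (π : Perm (Fin k)) (S : TMat n k) (x y : Fin k → Fin n) :
    (permMat n π * S) x y = S (fun i => x (π i)) y := by
  have h : ∀ z : Fin k → Fin n, (x = fun i => z (π⁻¹ i)) ↔ z = fun i => x (π i) := by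
    intro z
    constructor <;> rintro rfl <;> simp
  simp only [Matrix.mul_apply, permMat, Matrix.of_apply, h, ite_mul, one_mul, zero_mul,
    Finset.sum_ite_eq', Finset.mem_univ, if_true]

theorem mul_permMat_apply (π : Perm (Fin k)) (S : TMat n k) (x y : Fin k → Fin n) :
    (S * permMat n π) x y = S x (fun i => y (π⁻¹ i)) := by
  simp [Matrix.mul_apply, permMat]

/-- A tensor commuting with all permutations equals its own average over simultaneous permutations
of both indices. Averaging its expansion in matrix units makes it a combination of symmetrized
elementary tensors. -/
theorem commute_of_commute_permMat {T : TMat n k}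
    (hT : ∀ U ∈ Matrix.unitaryGroup (Fin n) ℂ, Commute T (tensorMat fun _ => U))
    {S : TMat n k} (hS : ∀ π, Commute S (permMat n π)) : Commute T S := by
  have hinv : ∀ (π : Perm (Fin k)) (u v : Fin k → Fin n),
      S (fun i => u (π i)) (fun i => v (π i)) = S u v := by
    intro π u v
    have := congrFun (congrFun (hS π).eq u) (fun i => v (π i))
    rw [permMat_mul_apply, mul_permMat_apply] at this
    simpa using this.symm
  have hsum : (Fintype.card (Perm (Fin k)) : ℂ) • S = ∑ u : Fin k → Fin n, ∑ v : Fin k → Fin n,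
      S u v • ∑ π : Perm (Fin k), tensorMat fun i => Matrix.single (u (π i)) (v (π i)) (1 : ℂ) := by
    have hπ : ∀ π : Perm (Fin k), S = ∑ u : Fin k → Fin n, ∑ v : Fin k → Fin n,
        S u v • tensorMat fun i => Matrix.single (u (π i)) (v (π i)) (1 : ℂ) := by
      intro π
      let e : (Fin k → Fin n) ≃ (Fin k → Fin n) := Equiv.arrowCongr π.symm (Equiv.refl _)
      have he : ∀ u, e u = fun i => u (π i) := fun u => rfl
      calc S = ∑ u, ∑ v, S u v • Matrix.single u v 1 := by
            conv_lhs => rw [Matrix.matrix_eq_sum_single S]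
            simp
        _ = ∑ u, ∑ v, S (e u) (e v) • Matrix.single (e u) (e v) 1 := by
            rw [← Equiv.sum_comp e]
            exact Finset.sum_congr rfl fun u _ => (Equiv.sum_comp e _).symm
        _ = _ := by
            refine Finset.sum_congr rfl fun u _ => Finset.sum_congr rfl fun v _ => ?_
            rw [he, he, hinv, ← tensorMat_single]
    calc (Fintype.card (Perm (Fin k)) : ℂ) • S = ∑ _π : Perm (Fin k), S := by
          rw [Finset.sum_const, Finset.card_univ, Nat.cast_smul_eq_nsmul]
      _ = _ := by
          rw [Finset.sum_congr rfl fun π _ => hπ π, Finset.sum_comm]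
          refine Finset.sum_congr rfl fun u _ => ?_
          rw [Finset.sum_comm]
          exact Finset.sum_congr rfl fun v _ => Finset.smul_sum.symm
  have hc : Commute T ((Fintype.card (Perm (Fin k)) : ℂ) • S) := by
    rw [hsum]
    exact Commute.sum_right _ _ _ fun u _ => Commute.sum_right _ _ _ fun v _ =>
      (commute_sum_perm_tensorMat hT fun i => Matrix.single (u i) (v i) 1).smul_right _
  exact (Commute.smul_right_iff₀ (Nat.cast_ne_zero.2 Fintype.card_ne_zero)).1 hc

/-! ### Double commutant argument -/

/-- There is a projection onto the span of the permutation operators that commutes with left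
multiplication by permutation operators. -/
theorem exists_equivariant_projection (n k : ℕ) : ∃ P : TMat n k →ₗ[ℂ] TMat n k,
    (∀ X, P X ∈ Submodule.span ℂ (Set.range (permMat n (k := k)))) ∧ P 1 = 1 ∧
    ∀ π X, P (permMat n π * X) = permMat n π * P X := by
  set W := Submodule.span ℂ (Set.range (permMat n (k := k))) with hW
  obtain ⟨Q, hQ⟩ := LinearMap.exists_leftInverse_of_injective W.subtype W.ker_subtype
  have hmem : ∀ π, permMat n π ∈ W := fun π => Submodule.subset_span ⟨π, rfl⟩
  have hQ' : ∀ X (hX : X ∈ W), (Q X : TMat n k) = X := fun X hX =>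
    congrArg Subtype.val (LinearMap.congr_fun hQ ⟨X, hX⟩)
  have hmulW : ∀ π, ∀ X ∈ W, permMat n π * X ∈ W := by
    intro π X hX
    refine Submodule.span_induction ?_ ?_ ?_ ?_ hX
    · rintro _ ⟨τ, rfl⟩
      rw [permMat_mul]
      exact hmem _
    · simp
    · intro X Y _ _ hX hY
      rw [mul_add]
      exact add_mem hX hY
    · intro c X _ hX
      rw [mul_smul_comm]
      exact W.smul_mem c hX
  -- Maschke averaging of the arbitrary linear retraction `Q`.
  let P : TMat n k →ₗ[ℂ] TMat n k := (Fintype.card (Perm (Fin k)) : ℂ)⁻¹ •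
    ∑ g : Perm (Fin k), LinearMap.mulLeft ℂ (permMat n g) ∘ₗ W.subtype ∘ₗ Q ∘ₗ
      LinearMap.mulLeft ℂ (permMat n g⁻¹)
  have hP : ∀ X, P X = (Fintype.card (Perm (Fin k)) : ℂ)⁻¹ •
      ∑ g : Perm (Fin k), permMat n g * (Q (permMat n g⁻¹ * X) : TMat n k) := by
    intro X
    simp [P, LinearMap.sum_apply]
  refine ⟨P, fun X => ?_, ?_, fun π X => ?_⟩
  · rw [hP]
    exact W.smul_mem _ (sum_mem fun g _ => hmulW _ _ (Q _).2)
  · have : ∀ g : Perm (Fin k), permMat n g * (Q (permMat n g⁻¹ * 1) : TMat n k) = 1 := by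
      intro g
      rw [mul_one, hQ' _ (hmem _), permMat_mul, mul_inv_cancel, permMat_one]
    rw [hP, Finset.sum_congr rfl fun g _ => this g, Finset.sum_const, Finset.card_univ,
      ← Nat.cast_smul_eq_nsmul ℂ, smul_smul,
      inv_mul_cancel₀ (Nat.cast_ne_zero.2 Fintype.card_ne_zero), one_smul]
  · rw [hP, hP, mul_smul_comm, Finset.mul_sum, ← Equiv.sum_comp (Equiv.mulLeft π)]
    congr 1
    refine Finset.sum_congr rfl fun g _ => ?_
    rw [Equiv.coe_mulLeft, mul_inv_rev, ← mul_assoc, ← mul_assoc, permMat_mul, permMat_mul,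
      inv_mul_cancel_right]

/-- **Schur–Weyl duality**: the commutant of the operators `U ⊗ ⋯ ⊗ U`, with `U` unitary, is spanned
by the permutation operators. -/
theorem mem_span_permMat {T : TMat n k}
    (hT : ∀ U ∈ Matrix.unitaryGroup (Fin n) ℂ, Commute T (tensorMat fun _ => U)) :
    T ∈ Submodule.span ℂ (Set.range (permMat n (k := k))) := by
  obtain ⟨P, hPW, hP1, hPg⟩ := exists_equivariant_projection n k
  -- The blocks of `P`, with `P` acting on matrices viewed as tuples of columns: `S y y'` sends
  -- column `y'` of the input to its contribution to column `y` of the output. Left multiplication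
  -- acts on each column alike, so it commutes with `P` iff it commutes with every block.
  let S : (Fin k → Fin n) → (Fin k → Fin n) → TMat n k := fun y y' =>
    Matrix.of fun x x' => P (Matrix.single x' y' 1) x y
  have hsingle : ∀ (R : TMat n k) (x' y' : Fin k → Fin n),
      R * Matrix.single x' y' 1 = ∑ z, R z x' • Matrix.single z y' 1 := by
    intro R x' y'
    ext x y
    simp [Matrix.mul_apply, Matrix.sum_apply, Matrix.single_apply, ite_and]
  have key : ∀ R : TMat n k, (∀ y y', Commute R (S y y')) ↔ ∀ X, P (R * X) = R * P X := by
    intro R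
    have h1 : ∀ x y x' y', P (R * Matrix.single x' y' 1) x y = (S y y' * R) x x' := by
      intro x y x' y'
      simp only [hsingle, map_sum, map_smul, Matrix.sum_apply, Matrix.smul_apply, smul_eq_mul,
        Matrix.mul_apply, S, Matrix.of_apply, mul_comm]
    have h2 : ∀ x y x' y', (R * P (Matrix.single x' y' 1)) x y = (R * S y y') x x' := by
      intro x y x' y'
      simp [Matrix.mul_apply, S]
    constructor
    · intro h
      have : P ∘ₗ LinearMap.mulLeft ℂ R = LinearMap.mulLeft ℂ R ∘ₗ P := by
        refine Matrix.ext_linearMap _ fun x' y' => LinearMap.ext_ring ?_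
        ext x y
        simp only [LinearMap.comp_apply, Matrix.singleLinearMap_apply, LinearMap.mulLeft_apply]
        rw [h1, h2, (h y y').eq]
      exact LinearMap.congr_fun this
    · intro h y y'
      ext x x'
      rw [← h1, ← h2, h]
  have hTP := (key T).1 (fun y y' => commute_of_commute_permMat hT fun π =>
    ((key _).2 (hPg π) y y').symm) 1
  rw [mul_one, hP1, mul_one] at hTP
  exact hTP ▸ hPW T

/-! ### Choi matrices and equivariance -/

theorem partialTranspose_mul_mul (m : ℕ) (A B : Fin k → Matrix (Fin n) (Fin n) ℂ) (C : TMat n k) :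
    partialTranspose m (tensorMat A * C * tensorMat B) =
      tensorMat (fun i => if (i : ℕ) < m then (B i)ᵀ else A i) * partialTranspose m C *
        tensorMat fun i => if (i : ℕ) < m then (A i)ᵀ else B i := by
  have h : partialTranspose m ∘ₗ LinearMap.mulRight ℂ (tensorMat B) ∘ₗ
        LinearMap.mulLeft ℂ (tensorMat A) =
      LinearMap.mulRight ℂ (tensorMat fun i => if (i : ℕ) < m then (A i)ᵀ else B i) ∘ₗ
        LinearMap.mulLeft ℂ (tensorMat fun i => if (i : ℕ) < m then (B i)ᵀ else A i) ∘ₗ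
          partialTranspose m := by
    refine linearMap_ext_tensorMat fun D => ?_
    simp only [LinearMap.comp_apply, LinearMap.mulLeft_apply, LinearMap.mulRight_apply,
      tensorMat_mul, partialTranspose_tensorMat]
    congr 1
    funext i
    split_ifs <;> simp [Matrix.transpose_mul, mul_assoc]
  exact LinearMap.congr_fun h C

theorem partialTranspose_partialTranspose (m : ℕ) (C : TMat n k) :
    partialTranspose m (partialTranspose m C) = C := by
  ext x y
  change C (fun i => if (i : ℕ) < m then (if (i : ℕ) < m then x i else y i) else
    (if (i : ℕ) < m then y i else x i)) (fun i => if (i : ℕ) < m then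
    (if (i : ℕ) < m then y i else x i) else (if (i : ℕ) < m then x i else y i)) = C x y
  congr 1 <;> funext i <;> split_ifs <;> rfl

/-- The linear equivalence between Choi matrices and linear maps, preceded by a partial
transposition. -/
def transposedChoiEquiv (m : ℕ) :
    TMat n (k + 1) ≃ₗ[ℂ] (Matrix (Fin n) (Fin n) ℂ →ₗ[ℂ] TMat n k) where
  toFun C := ofChoiMatrix (partialTranspose m C)
  invFun Φ := partialTranspose m (choiMatrix Φ)
  map_add' C D := by
    ext X x y
    simp [ofChoiMatrix, mul_add, Finset.sum_add_distrib]
  map_smul' c C := by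
    ext X x y
    simp [ofChoiMatrix, Finset.mul_sum, mul_left_comm]
  left_inv C := by
    beta_reduce
    rw [choiMatrix_ofChoiMatrix, partialTranspose_partialTranspose]
  right_inv Φ := by
    beta_reduce
    rw [partialTranspose_partialTranspose, ofChoiMatrix_choiMatrix]

theorem transposedChoiEquiv_apply (m : ℕ) (C : TMat n (k + 1)) :
    transposedChoiEquiv m C = ofChoiMatrix (partialTranspose m C) := rfl

theorem ofChoiMatrix_tensorMat (A : Fin (k + 1) → Matrix (Fin n) (Fin n) ℂ)
    (X : Matrix (Fin n) (Fin n) ℂ) :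
    ofChoiMatrix (tensorMat A) X = (Xᵀ * A 0).trace • tensorMat (Fin.tail A) := by
  ext x y
  simp only [ofChoiMatrix, LinearMap.coe_mk, AddHom.coe_mk, Matrix.of_apply, tensorMat,
    Fin.prod_univ_succ, Fin.cons_zero, Fin.cons_succ, Matrix.smul_apply, smul_eq_mul,
    Matrix.trace, Matrix.diag_apply, Matrix.mul_apply, Matrix.transpose_apply, Finset.sum_mul,
    Fin.tail]
  rw [Finset.sum_comm]
  simp only [mul_assoc]

/-- Conjugation of the Choi matrix by `V ⊗ A_1 ⊗ ⋯ ⊗ A_k` in terms of the linear map. -/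
theorem ofChoiMatrix_mul_mul (V W : Matrix (Fin n) (Fin n) ℂ)
    (A B : Fin k → Matrix (Fin n) (Fin n) ℂ) (C : TMat n (k + 1)) (X : Matrix (Fin n) (Fin n) ℂ) :
    ofChoiMatrix (tensorMat (Fin.cons V A : Fin (k + 1) → _) * C *
        tensorMat (Fin.cons W B : Fin (k + 1) → _)) X =
      tensorMat A * ofChoiMatrix C (Vᵀ * X * Wᵀ) * tensorMat B := by
  -- With `m = 0` nothing is transposed, so this is `ofChoiMatrix` as a linear map, and both sides
  -- can be compared on elementary tensors.
  let E : TMat n (k + 1) →ₗ[ℂ] (Matrix (Fin n) (Fin n) ℂ →ₗ[ℂ] TMat n k) :=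
    (transposedChoiEquiv 0).toLinearMap
  have hE : ∀ C : TMat n (k + 1), E C = ofChoiMatrix C := fun C => by
    simp only [E, LinearEquiv.coe_coe, transposedChoiEquiv_apply]
    rfl
  have h : LinearMap.applyₗ X ∘ₗ E ∘ₗ
        LinearMap.mulRight ℂ (tensorMat (Fin.cons W B : Fin (k + 1) → _)) ∘ₗ
          LinearMap.mulLeft ℂ (tensorMat (Fin.cons V A : Fin (k + 1) → _)) =
      LinearMap.mulRight ℂ (tensorMat B) ∘ₗ LinearMap.mulLeft ℂ (tensorMat A) ∘ₗ
        LinearMap.applyₗ (Vᵀ * X * Wᵀ) ∘ₗ E := by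
    refine linearMap_ext_tensorMat fun D => ?_
    simp only [LinearMap.comp_apply, LinearMap.mulLeft_apply, LinearMap.mulRight_apply,
      LinearMap.applyₗ_apply_apply, hE, tensorMat_mul, ofChoiMatrix_tensorMat, mul_smul_comm,
      smul_mul_assoc]
    congr 1
    simp only [Fin.cons_zero, Matrix.transpose_mul, Matrix.transpose_transpose]
    rw [← mul_assoc, Matrix.trace_mul_comm]
    simp only [mul_assoc]
  have h' := LinearMap.congr_fun h C
  simpa only [LinearMap.comp_apply, LinearMap.mulLeft_apply, LinearMap.mulRight_apply,
      LinearMap.applyₗ_apply_apply, hE] using h'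

/-- Transposition turns `U` into its conjugate in the input factor and the first `a` output factors,
whence `a + 1`. The Choi correspondence transposes the input factor once more, giving `Uᴴ * X * U`.
-/
theorem transposedChoiEquiv_conj (a b : ℕ) (U : Matrix (Fin n) (Fin n) ℂ)
    (C : TMat n (a + b + 1)) (X : Matrix (Fin n) (Fin n) ℂ) :
    transposedChoiEquiv (a + 1) (tensorMat (fun _ => U) * C * tensorMat fun _ => Uᴴ) X =
      mixedPower a b U * transposedChoiEquiv (a + 1) C (Uᴴ * X * U) * (mixedPower a b U)ᴴ := by
  have h1 : (fun i : Fin (a + b + 1) => if (i : ℕ) < a + 1 then Uᴴᵀ else U) =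
      Fin.cons (U.map star) fun i : Fin (a + b) => if (i : ℕ) < a then U.map star else U := by
    funext i
    refine Fin.cases ?_ (fun i => ?_) i
    · simp; rfl
    · simp; rfl
  have h2 : (fun i : Fin (a + b + 1) => if (i : ℕ) < a + 1 then Uᵀ else Uᴴ) =
      Fin.cons Uᵀ fun i : Fin (a + b) => if (i : ℕ) < a then Uᵀ else Uᴴ := by
    funext i
    refine Fin.cases ?_ (fun i => ?_) i
    · simp
    · simp
  have h3 : (mixedPower a b U)ᴴ = tensorMat fun i => if (i : ℕ) < a then Uᵀ else Uᴴ := by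
    rw [mixedPower, tensorMat_conjTranspose]
    congr 1
    funext i
    split_ifs
    · ext; simp
    · rfl
  rw [transposedChoiEquiv_apply, partialTranspose_mul_mul, h1, h2, ofChoiMatrix_mul_mul, h3]
  rfl

/-- A map is equivariant iff its partially transposed Choi matrix commutes with `U ⊗ ⋯ ⊗ U` for
every unitary `U`. -/
theorem transposedChoiEquiv_mem_equivariantMaps {a b : ℕ} {C : TMat n (a + b + 1)} :
    transposedChoiEquiv (a + 1) C ∈ equivariantMaps n a b ↔
      ∀ U ∈ Matrix.unitaryGroup (Fin n) ℂ, Commute C (tensorMat fun _ => U) := by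
  change IsUnitarilyEquivariant a b _ ↔ _
  refine forall₂_congr fun U hU => ?_
  have h1 : U * Uᴴ = 1 := Matrix.mem_unitaryGroup_iff.1 hU
  have h2 : Uᴴ * U = 1 := Matrix.mem_unitaryGroup_iff'.1 hU
  have hl : tensorMat (fun _ : Fin (a + b + 1) => U) * tensorMat (fun _ => Uᴴ) = 1 := by
    rw [tensorMat_mul, h1, tensorMat_one]
  have hr : tensorMat (fun _ : Fin (a + b + 1) => Uᴴ) * tensorMat (fun _ => U) = 1 := by
    rw [tensorMat_mul, h2, tensorMat_one]
  have hcomm : Commute C (tensorMat fun _ => U) ↔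
      tensorMat (fun _ => U) * C * tensorMat (fun _ => Uᴴ) = C := by
    constructor
    · intro h
      rw [← h.eq, mul_assoc, hl, mul_one]
    · intro h
      have := congrArg (· * tensorMat fun _ => U) h
      simp only [mul_assoc, hr, mul_one] at this
      exact this.symm
  rw [hcomm, ← (transposedChoiEquiv (a + 1)).injective.eq_iff, LinearMap.ext_iff]
  simp only [transposedChoiEquiv_conj]
  constructor
  · intro h X
    rw [← h]
    congr 1
    rw [← mul_assoc, ← mul_assoc, h1, one_mul, mul_assoc, h1, mul_one]
  · intro h X
    rw [← h]
    congr 3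
    rw [← mul_assoc, ← mul_assoc, h2, one_mul, mul_assoc, h2, mul_one]

theorem span_range_permMap (n a b : ℕ) :
    Submodule.span ℂ (Set.range (permMap n a b)) = equivariantMaps n a b := by
  have hperm : permMap n a b = transposedChoiEquiv (a + 1) ∘ permMat n := rfl
  apply le_antisymm
  · rw [Submodule.span_le]
    rintro _ ⟨π, rfl⟩
    rw [hperm]
    exact transposedChoiEquiv_mem_equivariantMaps.2 fun U _ =>
      (tensorMat_mul_permMat (fun _ => U) π).symm
  · intro Φ hΦ
    obtain ⟨C, rfl⟩ := (transposedChoiEquiv (a + 1)).surjective Φ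
    rw [hperm, Set.range_comp, ← LinearEquiv.coe_coe, ← Submodule.map_span]
    exact Submodule.mem_map_of_mem
      (mem_span_permMat (transposedChoiEquiv_mem_equivariantMaps.1 hΦ))

/-! ### Linear independence and the main theorem -/

theorem linearIndependent_permMat (h : k ≤ n) : LinearIndependent ℂ (permMat n (k := k)) := by
  rw [Fintype.linearIndependent_iff]
  intro c hc τ
  -- A word with distinct letters, available since `k ≤ n`: its rearrangements by different
  -- permutations differ, so in column `y` the entry in row `y ∘ τ⁻¹` isolates the coefficient of
  -- `τ`.
  let y : Fin k → Fin n := Fin.castLE h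
  have hy : Function.Injective y := Fin.castLE_injective h
  have hτ := congrFun (congrFun hc fun i => y (τ⁻¹ i)) y
  have hiff : ∀ π : Perm (Fin k), ((fun i => y (τ⁻¹ i)) = fun i => y (π⁻¹ i)) ↔ τ = π := by
    intro π
    constructor
    · intro h
      exact inv_injective (Equiv.ext fun i => hy (congrFun h i))
    · rintro rfl
      rfl
  simp only [Matrix.sum_apply, Matrix.smul_apply, permMat, Matrix.of_apply, hiff] at hτ
  simpa using hτ

theorem linearIndependent_permMap {n a b : ℕ} (h : a + b + 1 ≤ n) :
    LinearIndependent ℂ (permMap n a b) :=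
  (linearIndependent_permMat h).map' (transposedChoiEquiv (a + 1)).toLinearMap
    (LinearEquiv.ker _)

end EquivariantMaps
end

theorem mainTheorem5 (n a b : ℕ) :
    (∀ (π : Equiv.Perm (Fin (a + b + 1)))
        (Φ : Matrix (Fin n) (Fin n) ℂ →ₗ[ℂ] EquivariantMaps.TMat n (a + b)),
      EquivariantMaps.choiMatrix Φ =
          EquivariantMaps.partialTranspose (a + 1) (EquivariantMaps.permMat n π) ↔
        Φ = EquivariantMaps.permMap n a b π) ∧
    Submodule.span ℂ (Set.range (EquivariantMaps.permMap n a b)) =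
      EquivariantMaps.equivariantMaps n a b ∧
    (a + b + 1 ≤ n →
      (∃ B : Module.Basis (Equiv.Perm (Fin (a + b + 1))) ℂ
          (EquivariantMaps.equivariantMaps n a b),
        ∀ π, (B π : Matrix (Fin n) (Fin n) ℂ →ₗ[ℂ] EquivariantMaps.TMat n (a + b)) =
          EquivariantMaps.permMap n a b π) ∧
      Module.finrank ℂ (EquivariantMaps.equivariantMaps n a b) = (a + b + 1)!) := by
  refine ⟨fun π Φ => ⟨fun h => ?_, ?_⟩, EquivariantMaps.span_range_permMap n a b, fun hn => ?_⟩
  · rw [EquivariantMaps.permMap, ← h, EquivariantMaps.ofChoiMatrix_choiMatrix]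
  · rintro rfl
    exact EquivariantMaps.choiMatrix_ofChoiMatrix _
  · have hB : ∃ B : Module.Basis (Equiv.Perm (Fin (a + b + 1))) ℂ
        (EquivariantMaps.equivariantMaps n a b),
        ∀ π, (B π : Matrix (Fin n) (Fin n) ℂ →ₗ[ℂ] EquivariantMaps.TMat n (a + b)) =
          EquivariantMaps.permMap n a b π := by
      rw [← EquivariantMaps.span_range_permMap]
      exact ⟨Module.Basis.span (EquivariantMaps.linearIndependent_permMap hn),
        fun π => congrArg Subtype.val (Module.Basis.span_apply _ π)⟩
    refine ⟨hB, ?_⟩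
    obtain ⟨B, -⟩ := hB
    rw [Module.finrank_eq_card_basis B, Fintype.card_perm, Fintype.card_fin]
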